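/- Let $I$ be a finite set of agents and $N$ a finite set of items. Each agent wants at most one item and each item can be given to at most one agent. For each $i\in I$ let $T_i$ be a set of types, each type $\tau\in T_i$ being a strict total order on $N$; write $n\,\tau\,n'$ if $\tau$ ranks $n$ above $n'$. An agent of type $\tau$ ranks the items according to $\tau$ and prefers every item to receiving no item. A state is a profile $t=(t_i)_{i\in I}\in\prod_{i\in I}T_i$. Let $\succ$ (the principal's priority order) be a strict total order on the set of triples $\{(i,\tau,n): i\in I,\ \tau\in T_i,\ n\in N\}$. The greedy algorithm applied to $\succ$ in state $t$ goes through all triples in $\succ$-decreasing order and, at the triple $(i,\tau,n)$, gives item $n$ to agent $i$ if and only if $t_i=\tau$, agent $i$ has not yet been given an item, and item $n$ has not yet been given to an agent. A triple $(i,\tau,n)$ is unblocked if there is a state $t$ with $t_i=\tau$ in which the greedy algorithm applied to $\succ$ gives item $n$ to agent $i$. The order $\succ$ is - welfarist if, whenever $(i,\tau,n)$ is unblocked and $(i,\tau,n)\succ(i,\tau,n')$, then $n\,\tau\,n'$; - item-ranking consistent if, for all $n\in N$ and all agents $i\ne i'$, whenever $(i,\tau,n)$ is unblocked and $(i,\tau,n)\succ(i',\tau',n)$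 for some $\tau\in T_i$, $\tau'\in T_{i'}$, then $(i,\tau'',n)\succ(i',\tau''',n)$ for all $\tau''\in T_i$ and all $\tau'''\in T_{i'}$ such that $(i',\tau''',n)$ is unblocked. If $\succ$ is welfarist and item-ranking consistent, then the greedy algorithm applied to $\succ$, regarded as a direct mechanism that maps each reported profile $t\in\prod_{i}T_i$ to the resulting assignment, is dominant-strategy incentive compatible: for every agent $i$, every true type $t_i\in T_i$, every report $t_i'\in T_i$ and every profile $t_{-i}$ of reports of the other agents, an agent of type $t_i$ weakly prefers the outcome it gets at $(t_i,t_{-i})$ to the one it gets at $(t_i',t_{-i})$. -/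

import Mathlib

/-- A strict total order on `α`; `R.rel a b` reads "`a` is ranked above `b`". -/
structure StrictRanking (α : Type*) where
  rel : α → α → Prop
  isStrictTotalOrder : IsStrictTotalOrder α rel

namespace StrictRanking

theorem wf {α : Type*} [Finite α] (R : StrictRanking α) : WellFounded R.rel :=
  haveI := R.isStrictTotalOrder
  Finite.wellFounded_of_trans_of_irrefl R.rel

instance finite {α : Type*} [Finite α] : Finite (StrictRanking α) :=
  Finite.of_injective (fun R : StrictRanking α => R.rel) (by
    rintro ⟨r, hr⟩ ⟨s, hs⟩ h
    cases h
    rfl)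

end StrictRanking

namespace GreedyMatching

/-- `T i` is the set of possible types of agent `i`; a type is a strict ranking of the items.
A realization is a triple `(i, τ, n)` with `i` an agent, `τ ∈ T i` and `n` an item. -/
abbrev Realization {I N : Type*} (T : I → Set (StrictRanking N)) : Type _ :=
  Σ i : I, T i × N

/-- A state: a profile consisting of one type for each agent. -/
abbrev State {I N : Type*} (T : I → Set (StrictRanking N)) : Type _ :=
  (i : I) → T i

section Greedy

variable {I N : Type*} [Finite I] [Finite N] {T : I → Set (StrictRanking N)}

/-- The greedy algorithm for the priority order `R` in state `t`. The realizations are processed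
in decreasing `R`-order; `(i, τ, n)` is accepted (agent `i` is given item `n`) if and only if
`t i = τ` and no realization accepted earlier involves the agent `i` or the item `n`. -/
def Accepts (R : StrictRanking (Realization T)) (t : State T) : Realization T → Prop :=
  R.wf.fix fun p acc =>
    p.2.1 = t p.1 ∧ ∀ (q : Realization T) (h : R.rel q p), acc q h → q.1 ≠ p.1 ∧ q.2.2 ≠ p.2.2

theorem accepts_iff (R : StrictRanking (Realization T)) (t : State T) (p : Realization T) :
    Accepts R t p ↔
      p.2.1 = t p.1 ∧
        ∀ q : Realization T, R.rel q p → Accepts R t q → q.1 ≠ p.1 ∧ q.2.2 ≠ p.2.2 := by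
  unfold Accepts
  rw [WellFounded.fix_eq]

open Classical in
/-- The mechanism defined by the greedy algorithm: the item (if any) that each agent is given. -/
noncomputable def greedy (R : StrictRanking (Realization T)) (t : State T) (i : I) : Option N :=
  if h : ∃ n : N, Accepts R t ⟨i, t i, n⟩ then some h.choose else none

/-- An agent is given at most one item, so `greedy` involves no arbitrary choice. -/
theorem greedy_eq_some_iff (R : StrictRanking (Realization T)) (t : State T) (i : I) (n : N) :
    greedy R t i = some n ↔ Accepts R t ⟨i, t i, n⟩ := by
  haveI := R.isStrictTotalOrder
  have uniq : ∀ m m' : N, Accepts R t ⟨i, t i, m⟩ → Accepts R t ⟨i, t i, m'⟩ → m = m' := by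
    intro m m' hm hm'
    rcases trichotomous_of R.rel (⟨i, t i, m⟩ : Realization T) ⟨i, t i, m'⟩ with h | h | h
    · exact absurd rfl (((accepts_iff R t _).1 hm').2 _ h hm).1
    · simpa using h
    · exact absurd rfl (((accepts_iff R t _).1 hm).2 _ h hm').1
  unfold greedy
  split_ifs with h
  · rw [Option.some_inj]
    exact ⟨fun e => e ▸ h.choose_spec, fun hn => uniq _ _ h.choose_spec hn⟩
  · simp only [reduceCtorEq, false_iff]
    exact fun hn => h ⟨n, hn⟩

/-- Every item is given to at most one agent. -/
theorem greedy_injective (R : StrictRanking (Realization T)) (t : State T) (i j : I) (n : N)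
    (hi : greedy R t i = some n) (hj : greedy R t j = some n) : i = j := by
  haveI := R.isStrictTotalOrder
  rw [greedy_eq_some_iff] at hi hj
  rcases trichotomous_of R.rel (⟨i, t i, n⟩ : Realization T) ⟨j, t j, n⟩ with h | h | h
  · exact absurd rfl (((accepts_iff R t _).1 hj).2 _ h hi).2
  · exact congrArg Sigma.fst h
  · exact absurd rfl (((accepts_iff R t _).1 hi).2 _ h hj).2

/-- `(i, τ, n)` is unblocked if in some state in which agent `i` has type `τ` the greedy
algorithm gives item `n` to agent `i`. -/
def Unblocked (R : StrictRanking (Realization T)) (i : I) (τ : T i) (n : N) : Prop :=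
  ∃ t : State T, t i = τ ∧ greedy R t i = some n

def IsItemRankingConsistent (R : StrictRanking (Realization T)) : Prop :=
  ∀ (n : N) (i i' : I), i ≠ i' → ∀ (τ : T i) (τ' : T i'),
    Unblocked R i τ n → R.rel ⟨i, τ, n⟩ ⟨i', τ', n⟩ →
      ∀ (τ'' : T i) (τ''' : T i'), Unblocked R i' τ''' n → R.rel ⟨i, τ'', n⟩ ⟨i', τ''', n⟩

def IsWelfarist (R : StrictRanking (Realization T)) : Prop :=
  ∀ (i : I) (τ : T i) (n n' : N),
    Unblocked R i τ n → R.rel ⟨i, τ, n⟩ ⟨i, τ, n'⟩ → τ.1.rel n n'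

end Greedy

/-- Weak preference of an agent with ranking `τ` over outcomes, where `none` (receiving no item)
is worse than every item. -/
def WeaklyPrefers {N : Type*} (τ : StrictRanking N) : Option N → Option N → Prop
  | _, none => True
  | none, some _ => False
  | some n, some n' => n = n' ∨ τ.rel n n'

/-- Dominant-strategy incentive compatibility of a direct mechanism `f` that maps reported type
profiles to an outcome for each agent: whatever the others report, an agent `i` of type `t i`
weakly prefers the outcome of the truthful report to that of any other report. -/
def IsDSIC {I N : Type*} {T : I → Set (StrictRanking N)} (f : State T → I → Option N) : Prop :=
  ∀ (i : I) (t t' : State T), (∀ j, j ≠ i → t' j = t j) →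
    WeaklyPrefers (t i).1 (f t i) (f t' i)

end GreedyMatching

/-! Suppose `i` gains from a misreport, and let `J` be the set of agents strictly better off at `t'`
than at `t`, judged by their types in `t`. The item that `j ∈ J` gets at `t'` is held at `t` by an
agent `k` of higher priority for it (`IsWelfarist.exists_holder`), and `k` is again in `J`
(`IsWelfarist.strictlyPrefers_of_loses`). By welfarism, `k` in turn gains an item on which it has
higher priority than on the one it holds. Iterating `j ↦ k` thus gives an infinite ascent in a
finite order. -/

namespace StrictRanking

theorem asymm {α : Type*} (R : StrictRanking α) {a b : α} (h : R.rel a b) : ¬ R.rel b a :=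
  haveI := R.isStrictTotalOrder
  fun h' => irrefl_of R.rel a (trans_of R.rel h h')

theorem trans {α : Type*} (R : StrictRanking α) {a b c : α} (h : R.rel a b) (h' : R.rel b c) :
    R.rel a c :=
  haveI := R.isStrictTotalOrder
  trans_of R.rel h h'

theorem total {α : Type*} (R : StrictRanking α) (a b : α) : R.rel a b ∨ a = b ∨ R.rel b a :=
  haveI := R.isStrictTotalOrder
  trichotomous_of R.rel a b

end StrictRanking

namespace GreedyMatching

/-- An agent with ranking `τ` strictly prefers the outcome `o'` to the outcome `o`. -/
def StrictlyPrefers {N : Type*} (τ : StrictRanking N) (o' o : Option N) : Prop :=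
  ∃ m, o' = some m ∧ ∀ n, o = some n → τ.rel m n

theorem strictlyPrefers_of_not_weaklyPrefers {N : Type*} {τ : StrictRanking N}
    {o o' : Option N} (h : ¬ WeaklyPrefers τ o o') : StrictlyPrefers τ o' o := by
  rcases o' with _ | m
  · exact absurd (by cases o <;> trivial) h
  refine ⟨m, rfl, ?_⟩
  rintro n rfl
  rcases τ.total m n with hmn | hmn | hmn
  · exact hmn
  · exact absurd (Or.inl hmn.symm) h
  · exact absurd (Or.inr hmn) h

variable {I N : Type*} [Finite I] [Finite N] {T : I → Set (StrictRanking N)}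
  {R : StrictRanking (Realization T)}

theorem unblocked_of_greedy {t : State T} {i : I} {n : N} (h : greedy R t i = some n) :
    Unblocked R i (t i) n :=
  ⟨t, rfl, h⟩

/-- An agent who is not given an item was earlier given another one, or the item was earlier
given to another agent. -/
theorem exists_rel_of_greedy_ne {t : State T} {i : I} {n : N} (h : greedy R t i ≠ some n) :
    (∃ m, greedy R t i = some m ∧ R.rel ⟨i, t i, m⟩ ⟨i, t i, n⟩) ∨
      ∃ k, k ≠ i ∧ greedy R t k = some n ∧ R.rel ⟨k, t k, n⟩ ⟨i, t i, n⟩ := by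
  rw [Ne, greedy_eq_some_iff, accepts_iff] at h
  push Not at h
  obtain ⟨⟨k, σ, m⟩, hq, hacc, hkm⟩ := h rfl
  obtain rfl : σ = t k := ((accepts_iff R t _).1 hacc).1
  by_cases hk : k = i
  · subst hk
    exact Or.inl ⟨m, (greedy_eq_some_iff R t _ m).2 hacc, hq⟩
  · obtain rfl : m = n := hkm hk
    exact Or.inr ⟨k, hk, (greedy_eq_some_iff R t k m).2 hacc, hq⟩

/-- An item that an agent would strictly prefer to its own is held by an agent of higher
priority. -/
theorem IsWelfarist.exists_holder (hw : IsWelfarist R) {t : State T} {j : I} {m : N}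
    (h : ∀ n, greedy R t j = some n → (t j).1.rel m n) :
    ∃ k, k ≠ j ∧ greedy R t k = some m ∧ R.rel ⟨k, t k, m⟩ ⟨j, t j, m⟩ := by
  have hne : greedy R t j ≠ some m := fun e => (t j).1.asymm (h m e) (h m e)
  rcases exists_rel_of_greedy_ne hne with ⟨n, hn, hr⟩ | hk
  · exact absurd (hw j _ n m (unblocked_of_greedy hn) hr) ((t j).1.asymm (h n hn))
  · exact hk

/-- If a unilateral deviation by `i` gives `j` an item `m` that was held by an agent `k ≠ i` of
higher priority, then `k` strictly gains from the deviation as well. -/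
theorem IsWelfarist.strictlyPrefers_of_loses (hw : IsWelfarist R)
    (hc : IsItemRankingConsistent R) {t t' : State T} {j k : I} {m : N} (htk : t' k = t k)
    (hkj : k ≠ j) (hk : greedy R t k = some m) (hr : R.rel ⟨k, t k, m⟩ ⟨j, t j, m⟩)
    (hj : greedy R t' j = some m) :
    StrictlyPrefers (t k).1 (greedy R t' k) (greedy R t k) := by
  have hne : greedy R t' k ≠ some m := fun e => hkj (greedy_injective R t' k j m e hj)
  rcases exists_rel_of_greedy_ne hne with ⟨n, hn, hnm⟩ | ⟨l, -, hl, hlk⟩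
  · refine ⟨n, hn, fun m' hm' => ?_⟩
    obtain rfl : m = m' := Option.some_injective _ (hk.symm.trans hm')
    -- The item `n` is known to be unblocked only through `t'`, hence for the type `t' k`.
    rw [← htk]
    exact hw k _ n m (unblocked_of_greedy hn) hnm
  · obtain rfl : l = j := greedy_injective R t' l j m hl hj
    exact absurd hlk (R.asymm (hc m k l hkj (t k) (t l) (unblocked_of_greedy hk) hr (t' k) (t' l)
      (unblocked_of_greedy hj)))

/-- No agent gains from a misreport: an item desired by an agent who gains is held by another
agent who gains and has higher priority, so that priorities would increase forever. -/
theorem isDSIC_greedy (hw : IsWelfarist R) (hc : IsItemRankingConsistent R) :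
    IsDSIC (greedy R) := by
  intro i t t' htt'
  by_contra hi
  replace hi := strictlyPrefers_of_not_weaklyPrefers hi
  let J := {j : I // StrictlyPrefers (t j).1 (greedy R t' j) (greedy R t j)}
  have step : ∀ j : J, ∃ k : J, ∃ m, greedy R t' j = some m ∧ greedy R t k = some m ∧
      R.rel ⟨k, t k, m⟩ ⟨j, t j, m⟩ := by
    rintro ⟨j, m, hm, hpref⟩
    obtain ⟨k, hkj, hk, hr⟩ := hw.exists_holder hpref
    refine ⟨⟨k, ?_⟩, m, hm, hk, hr⟩
    -- The deviator's type changes, so the lemma does not cover it, but it gains by assumption.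
    by_cases hki : k = i
    · exact hki ▸ hi
    · exact hw.strictlyPrefers_of_loses hc (htt' k hki) hkj hk hr hm
  choose f g hg' hg hr using step
  -- The triple attached to `j` is an assignment made at `t`: `f j` holds `g j`. The intermediate
  -- triple pairs `f j` with the item `g (f j)` that it gains.
  have climb : ∀ j : J, R.rel ⟨f (f j), t (f (f j)), g (f j)⟩ ⟨f j, t (f j), g j⟩ := by
    intro j
    refine R.trans (hr (f j)) ?_
    obtain ⟨m, hm, hpref⟩ := (f j).2
    obtain rfl : m = g (f j) := Option.some_injective _ (hm.symm.trans (hg' (f j)))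
    have hlt := hpref (g j) (hg j)
    rcases R.total ⟨f j, t (f j), g (f j)⟩ ⟨f j, t (f j), g j⟩ with h | h | h
    · exact h
    · have hg_eq : g (f j) = g j := by simpa using h
      rw [hg_eq] at hlt
      exact absurd hlt ((t (f j)).1.asymm hlt)
    · exact absurd (hw _ _ _ _ (unblocked_of_greedy (hg j)) h) ((t (f j)).1.asymm hlt)
  -- Minimal for `R.rel` means of highest priority.
  obtain ⟨p, ⟨j, rfl⟩, hmin⟩ := R.wf.has_min
    (Set.range fun j : J => (⟨f j, t (f j), g j⟩ : Realization T)) ⟨_, ⟨i, hi⟩, rfl⟩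
  exact hmin _ ⟨f j, rfl⟩ (climb j)

end GreedyMatching

theorem mainTheorem8 {I N : Type*} [Finite I] [Finite N] (T : I → Set (StrictRanking N))
    (R : StrictRanking (GreedyMatching.Realization T))
    (hw : GreedyMatching.IsWelfarist R) (hc : GreedyMatching.IsItemRankingConsistent R) :
    GreedyMatching.IsDSIC (GreedyMatching.greedy R) :=
  GreedyMatching.isDSIC_greedy hw hc
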